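/- Let $G$ be a compact (Hausdorff) group with a left Haar measure $\lambda$. An $N$-function is a convex even function $\Phi:\mathbb{R}\to[0,\infty)$ with $\Phi(0)=0$, $\lim_{x\to 0}\Phi(x)/x=0$ and $\lim_{x\to\infty}\Phi(x)/x=\infty$; its complementary function is $\Psi(y)=\sup\{x|y|-\Phi(x): x\ge 0\}$. For a complex-valued measurable function $f$ on $G$ (functions that agree almost everywhere being identified) put $\rho_\Phi(f)=\int_G\Phi(|f|)\,d\lambda$ and $N_\Phi(f)=\inf\{k>0:\rho_\Phi(f/k)\le 1\}$ (with $\inf\emptyset=\infty$), and let $M^\Phi(G)$ be the space of those $f$ with $\rho_\Phi(af)<\infty$ for all $a>0$; $\rho_\Psi$ and $M^\Psi(G)$ are defined in the same way from $\Psi$. Put $\|g\|_\Psi=\sup\{\int_G|gh|\,d\lambda: h \text{ measurable},\ N_\Phi(h)\le 1\}$ for measurable $g$. Write $(f*g)(x)=\int_G f(y)g(y^{-1}x)\,d\lambda(y)$ and $\check g(x)=g(x^{-1})$. Let $A_\Phi(G)$ be the space of all continuous functions $u:G\to\mathbb{C}$ of the form $u=\sum_{n=1}^\infty f_n*\check g_n$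 with $f_n\in M^\Phi(G)$, $g_n\in M^\Psi(G)$ and $\sum_{n=1}^\infty N_\Phi(f_n)\|g_n\|_\Psi<\infty$, normed by $$\|u\|_{A_\Phi}=\inf\Big\{\sum_{n=1}^\infty N_\Phi(f_n)\|g_n\|_\Psi : u=\sum_{n=1}^\infty f_n*\check g_n\Big\},$$ the infimum being over all such representations. As $G$ is compact, $A_\Phi(G)$ is a Banach algebra under convolution (a Banach space with an associative bilinear product such that $\|u*v\|_{A_\Phi}\le C\|u\|_{A_\Phi}\|v\|_{A_\Phi}$ for a constant $C$). For this Banach algebra the following are equivalent: (i) $A_\Phi(G)$ has a bounded approximate identity, i.e. a bounded net $(e_i)$ with $e_i*u\to u$ and $u*e_i\to u$ in $\|\cdot\|_{A_\Phi}$ for every $u\in A_\Phi(G)$. (ii) $A_\Phi(G)$ is unital, i.e. it has a two-sided identity for convolution. (iii) $A_\Phi(G)$ is amenable, i.e. for every Banach $A_\Phi(G)$-bimodule $E$, every bounded derivation $D:A_\Phi(G)\to E^*$ into the dual bimodule is inner. (iv) $G$ is finite. -/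

import Mathlib

open MeasureTheory Filter Topology
open scoped ENNReal ZeroAtInfty

universe u

set_option linter.unusedSectionVars false
set_option linter.overlappingInstances false

noncomputable section

/-! ### Orlicz spaces -/

namespace Orlicz

/-- An `N`-function: a convex even function `Φ : ℝ → [0, ∞)` with `Φ 0 = 0`,
`Φ x / x → 0` as `x → 0` and `Φ x / x → ∞` as `x → ∞`. -/
structure NFunction where
  toFun : ℝ → ℝ
  nonneg : ∀ x, 0 ≤ toFun x
  convex : ConvexOn ℝ Set.univ toFun
  even : ∀ x, toFun (-x) = toFun x
  map_zero : toFun 0 = 0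
  tendsto_zero : Tendsto (fun x => toFun x / x) (𝓝[≠] 0) (𝓝 0)
  tendsto_top : Tendsto (fun x => toFun x / x) atTop atTop

/-- The complementary function `Ψ y = sup {x |y| - Φ x : x ≥ 0}`. -/
def compl (Φ : ℝ → ℝ) (y : ℝ) : ℝ :=
  sSup ((fun x : ℝ => x * |y| - Φ x) '' Set.Ici 0)

variable {G : Type u} [MeasurableSpace G]

/-- The modular `ρ_Φ(f) = ∫ Φ(|f|) dμ`, with values in `[0, ∞]`. -/
def modular (Φ : ℝ → ℝ) (μ : Measure G) (f : G → ℂ) : ℝ≥0∞ :=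
  ∫⁻ x, ENNReal.ofReal (Φ ‖f x‖) ∂μ

/-- The Luxemburg–Nakano norm `N_Φ(f) = inf {k > 0 : ρ_Φ(f / k) ≤ 1}`; it is `∞` when there is
no such `k`, that is, when `f` lies outside the Orlicz space. -/
def luxNorm (Φ : ℝ → ℝ) (μ : Measure G) (f : G → ℂ) : ℝ≥0∞ :=
  ⨅ (k : ℝ) (_ : 0 < k ∧ modular Φ μ (fun x => f x / (k : ℂ)) ≤ 1), ENNReal.ofReal k

/-- The Orlicz norm `‖f‖_Φ = sup {∫ |f g| dμ : g measurable, N_Ψ(g) ≤ 1}`, where `Ψ` is the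
complementary function of `Φ`. -/
def orliczNorm (Φ : ℝ → ℝ) (μ : Measure G) (f : G → ℂ) : ℝ≥0∞ :=
  ⨆ (g : G → ℂ) (_ : AEStronglyMeasurable g μ ∧ luxNorm (compl Φ) μ g ≤ 1),
    ∫⁻ x, ‖f x * g x‖ₑ ∂μ

/-- `f` belongs to the Morse–Transue space: `ρ_Φ(a f) < ∞` for all `a > 0`. -/
def MemMorseTransue (Φ : ℝ → ℝ) (μ : Measure G) (f : G → ℂ) : Prop :=
  AEStronglyMeasurable f μ ∧ ∀ a : ℝ, 0 < a → modular Φ μ (fun x => (a : ℂ) * f x) < ∞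

/-! Elementary facts about these notions. -/

lemma bddAbove_compl (Φ : NFunction) (y : ℝ) :
    BddAbove ((fun x : ℝ => x * |y| - Φ.toFun x) '' Set.Ici 0) := by
  obtain ⟨X, hX⟩ := (Φ.tendsto_top.eventually_ge_atTop |y|).exists_forall_of_atTop
  refine ⟨max X 0 * |y|, ?_⟩
  rintro _ ⟨x, hx, rfl⟩
  have hx : 0 ≤ x := hx
  have hy := abs_nonneg y
  have hΦ := Φ.nonneg x
  simp only
  rcases le_total x (max X 0) with h | h
  · nlinarith [mul_le_mul_of_nonneg_right h hy]
  · rcases hx.eq_or_lt with rfl | hx0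
    · have : 0 ≤ max X 0 * |y| := by positivity
      simp only [zero_mul]; linarith
    · have h1 := hX x ((le_max_left _ _).trans h)
      rw [le_div_iff₀ hx0] at h1
      have : 0 ≤ max X 0 * |y| := by positivity
      nlinarith

lemma young (Φ : NFunction) {x : ℝ} (hx : 0 ≤ x) (y : ℝ) :
    x * |y| - Φ.toFun x ≤ compl Φ.toFun y :=
  le_csSup (bddAbove_compl Φ y) ⟨x, hx, rfl⟩

lemma even_abs (Φ : NFunction) (x : ℝ) : Φ.toFun |x| = Φ.toFun x := by
  rcases abs_choice x with h | h <;> rw [h]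
  exact Φ.even x

lemma bddAbove_compl_compl (Φ : NFunction) (x : ℝ) :
    Φ.toFun x ∈ upperBounds ((fun y : ℝ => y * |x| - compl Φ.toFun y) '' Set.Ici 0) := by
  rintro _ ⟨y, hy, rfl⟩
  have h := young Φ (abs_nonneg x) y
  rw [abs_of_nonneg (show (0 : ℝ) ≤ y from hy), even_abs] at h
  simp only
  linarith

lemma compl_compl_le (Φ : NFunction) (x : ℝ) :
    compl (compl Φ.toFun) x ≤ Φ.toFun x :=
  csSup_le (Set.Nonempty.image _ ⟨0, Set.self_mem_Ici⟩) fun _ h => bddAbove_compl_compl Φ x h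

lemma young' (Φ : NFunction) {y : ℝ} (hy : 0 ≤ y) {x : ℝ} (hx : 0 ≤ x) :
    x * y ≤ compl Φ.toFun x + compl (compl Φ.toFun) y := by
  have := le_csSup ⟨_, bddAbove_compl_compl Φ y⟩
    (Set.mem_image_of_mem (fun x : ℝ => x * |y| - compl Φ.toFun x) (show x ∈ Set.Ici 0 from hx))
  simp only [abs_of_nonneg hy] at this
  change _ ≤ sSup _ at this
  unfold compl at this ⊢
  simp only [abs_of_nonneg hy] at this ⊢
  linarith

lemma monotoneOn (Φ : NFunction) : MonotoneOn Φ.toFun (Set.Ici 0) := by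
  intro x hx y hy hxy
  have hx : 0 ≤ x := hx
  rcases (hx.trans hxy).eq_or_lt with rfl | hy0
  · rw [le_antisymm hxy hx]
  have h := Φ.convex.2 (Set.mem_univ (0 : ℝ)) (Set.mem_univ y)
    (sub_nonneg.2 ((div_le_one hy0).2 hxy)) (div_nonneg hx hy0.le) (by ring)
  simp only [smul_eq_mul, mul_zero, zero_add, Φ.map_zero, div_mul_cancel₀ x hy0.ne'] at h
  exact h.trans (mul_le_of_le_one_left (Φ.nonneg y) ((div_le_one hy0).2 hxy))

lemma monotoneOn_compl (Φ : NFunction) : MonotoneOn (compl Φ.toFun) (Set.Ici 0) := by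
  intro y hy z hz hyz
  refine csSup_le (Set.Nonempty.image _ ⟨0, Set.self_mem_Ici⟩) ?_
  rintro _ ⟨x, hx, rfl⟩
  refine le_trans ?_ (young Φ hx z)
  have : |y| ≤ |z| := abs_le_abs_of_nonneg hy hyz
  have := mul_le_mul_of_nonneg_left this (show (0 : ℝ) ≤ x from hx)
  simp only
  linarith

variable {μ : Measure G}

lemma luxNorm_mono {Φ : ℝ → ℝ} (hΦ : MonotoneOn Φ (Set.Ici 0)) {f g : G → ℂ}
    (h : ∀ x, ‖f x‖ ≤ ‖g x‖) : luxNorm Φ μ f ≤ luxNorm Φ μ g := by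
  refine le_iInf₂ fun k hk => iInf₂_le k ⟨hk.1, le_trans (lintegral_mono fun x => ?_) hk.2⟩
  refine ENNReal.ofReal_le_ofReal (hΦ (norm_nonneg _) (norm_nonneg _) ?_)
  rw [norm_div, norm_div]
  gcongr
  exact h x

lemma luxNorm_const_mul_le (Φ : ℝ → ℝ) (f : G → ℂ) {c : ℂ} (hc : c ≠ 0) :
    luxNorm Φ μ (fun x => c * f x) ≤ ‖c‖ₑ * luxNorm Φ μ f := by
  unfold luxNorm
  rw [ENNReal.mul_iInf_of_ne (by simpa using hc) (by simp)]
  refine le_iInf fun k => ?_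
  rw [ENNReal.mul_iInf_of_ne (by simpa using hc) (by simp)]
  refine le_iInf fun hk => ?_
  have hc' : 0 < ‖c‖ := norm_pos_iff.2 hc
  have hmod : modular Φ μ (fun x => c * f x / ((‖c‖ * k : ℝ) : ℂ)) ≤ 1 := by
    refine le_trans (le_of_eq ?_) hk.2
    unfold modular
    refine lintegral_congr fun x => ?_
    congr 2
    rw [Complex.ofReal_mul]
    simp only [norm_div, norm_mul, Complex.norm_real, Real.norm_eq_abs, abs_of_pos hk.1,
      abs_of_pos hc']
    field_simp
  refine (iInf₂_le (‖c‖ * k) ⟨mul_pos hc' hk.1, hmod⟩).trans (le_of_eq ?_)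
  rw [ENNReal.ofReal_mul hc'.le, ofReal_norm]

lemma orliczNorm_const_mul (Φ : ℝ → ℝ) (f : G → ℂ) (c : ℂ) :
    orliczNorm Φ μ (fun x => c * f x) = ‖c‖ₑ * orliczNorm Φ μ f := by
  unfold orliczNorm
  simp only [ENNReal.mul_iSup]
  congr! 5 with g hg
  rw [← lintegral_const_mul' _ _ (by simp)]
  simp [enorm_mul, mul_assoc]

lemma orliczNorm_mono (Φ : ℝ → ℝ) {f g : G → ℂ} (h : ∀ x, ‖f x‖ ≤ ‖g x‖) :
    orliczNorm Φ μ f ≤ orliczNorm Φ μ g := by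
  refine iSup₂_mono fun k _ => lintegral_mono fun x => ?_
  simp only [enorm_mul]
  gcongr
  exact enorm_le_iff_norm_le.2 (h x)

lemma orliczNorm_zero (Φ : ℝ → ℝ) : orliczNorm Φ μ (fun _ => 0) = 0 := by
  simp [orliczNorm]

lemma luxNorm_ne_top (Φ : NFunction) {f : G → ℂ} (hf : MemMorseTransue Φ.toFun μ f) :
    luxNorm Φ.toFun μ f ≠ ∞ := by
  have h1 := hf.2 1 one_pos
  simp only [Complex.ofReal_one, one_mul] at h1
  set r := (modular Φ.toFun μ f).toReal with hr
  have hr0 : 0 ≤ r := ENNReal.toReal_nonneg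
  have hk : 0 < r + 1 := by linarith
  refine ne_top_of_le_ne_top ENNReal.ofReal_ne_top (iInf₂_le (r + 1) ⟨hk, ?_⟩)
  calc modular Φ.toFun μ (fun x => f x / ((r + 1 : ℝ) : ℂ))
      ≤ ∫⁻ x, ENNReal.ofReal (r + 1)⁻¹ * ENNReal.ofReal (Φ.toFun ‖f x‖) ∂μ := by
        refine lintegral_mono fun x => ?_
        rw [← ENNReal.ofReal_mul (by positivity)]
        refine ENNReal.ofReal_le_ofReal ?_
        have h := Φ.convex.2 (Set.mem_univ (0 : ℝ)) (Set.mem_univ ‖f x‖)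
          (sub_nonneg.2 (inv_le_one_of_one_le₀ (show 1 ≤ r + 1 by linarith)))
          (show 0 ≤ (r + 1)⁻¹ by positivity) (by ring)
        simp only [smul_eq_mul, mul_zero, zero_add, Φ.map_zero] at h
        rwa [norm_div, Complex.norm_real, Real.norm_eq_abs, abs_of_pos hk, div_eq_inv_mul]
    _ = ENNReal.ofReal (r + 1)⁻¹ * ENNReal.ofReal r := by
        rw [lintegral_const_mul' _ _ ENNReal.ofReal_ne_top, hr, ENNReal.ofReal_toReal h1.ne]
        rfl
    _ ≤ 1 := by
        rw [← ENNReal.ofReal_mul (by positivity), ← ENNReal.ofReal_one]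
        refine ENNReal.ofReal_le_ofReal ?_
        rw [inv_mul_le_iff₀ hk]; linarith

lemma orliczNorm_compl_ne_top (Φ : NFunction) {f : G → ℂ}
    (hf : MemMorseTransue (compl Φ.toFun) μ f) : orliczNorm (compl Φ.toFun) μ f ≠ ∞ := by
  have h1 := hf.2 1 one_pos
  simp only [Complex.ofReal_one, one_mul] at h1
  have hmeas : AEMeasurable (fun x => ENNReal.ofReal (compl Φ.toFun ‖f x‖)) μ := by
    have hm : Monotone fun t : ℝ => compl Φ.toFun (max t 0) := fun s t hst =>
      monotoneOn_compl Φ (Set.mem_Ici.2 (le_max_right _ _)) (Set.mem_Ici.2 (le_max_right _ _)) (max_le_max_right _ hst)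
    have := (hm.measurable.comp_aemeasurable hf.1.norm.aemeasurable).ennreal_ofReal
    simpa only [Function.comp_def, max_eq_left (norm_nonneg _)] using this
  refine ne_top_of_le_ne_top (b := 2 * (modular (compl Φ.toFun) μ f + 1))
    (ENNReal.mul_ne_top (by simp) (ENNReal.add_ne_top.2 ⟨h1.ne, by simp⟩)) ?_
  refine iSup₂_le fun g hg => ?_
  have hlt : luxNorm (compl (compl Φ.toFun)) μ g < 2 := hg.2.trans_lt (by norm_num)
  unfold luxNorm at hlt
  simp only [iInf_lt_iff] at hlt
  obtain ⟨k, ⟨hk0, hk1⟩, hk2⟩ := hlt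
  calc ∫⁻ x, ‖f x * g x‖ₑ ∂μ
      ≤ ∫⁻ x, ENNReal.ofReal k * (ENNReal.ofReal (compl Φ.toFun ‖f x‖)
          + ENNReal.ofReal (compl (compl Φ.toFun) ‖g x / (k : ℂ)‖)) ∂μ := by
        refine lintegral_mono fun x => ?_
        refine le_trans ?_ (mul_le_mul_right ENNReal.ofReal_add_le _)
        rw [← ENNReal.ofReal_mul hk0.le, ← ofReal_norm]
        refine ENNReal.ofReal_le_ofReal ?_
        refine le_trans (le_of_eq ?_)
          (mul_le_mul_of_nonneg_left (young' Φ (norm_nonneg _) (norm_nonneg _)) hk0.le)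
        rw [norm_mul, norm_div, Complex.norm_real, Real.norm_eq_abs, abs_of_pos hk0]
        field_simp
    _ = ENNReal.ofReal k * (modular (compl Φ.toFun) μ f
          + modular (compl (compl Φ.toFun)) μ (fun x => g x / (k : ℂ))) := by
        rw [lintegral_const_mul' _ _ ENNReal.ofReal_ne_top, lintegral_add_left' hmeas]
        rfl
    _ ≤ 2 * (modular (compl Φ.toFun) μ f + 1) := by gcongr

/-- Hölder's inequality for the Luxemburg norm and the Orlicz norm. -/
lemma holder (Φ : NFunction) {f g : G → ℂ} (hf : MemMorseTransue Φ.toFun μ f)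
    (hg : MemMorseTransue (compl Φ.toFun) μ g) :
    ∫⁻ x, ‖f x * g x‖ₑ ∂μ ≤ luxNorm Φ.toFun μ f * orliczNorm (compl Φ.toFun) μ g := by
  have hg' := orliczNorm_compl_ne_top Φ hg
  have hf' := luxNorm_ne_top Φ hf
  have key : ∀ k : ℝ, (0 < k ∧ modular Φ.toFun μ (fun x => f x / (k : ℂ)) ≤ 1) →
      ∫⁻ x, ‖f x * g x‖ₑ ∂μ ≤ ENNReal.ofReal k * orliczNorm (compl Φ.toFun) μ g := by
    rintro k ⟨hk, hk1⟩
    have h2 : ∫⁻ x, ‖g x * (f x / (k : ℂ))‖ₑ ∂μ ≤ orliczNorm (compl Φ.toFun) μ g := by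
      refine le_iSup₂_of_le (fun x => f x / (k : ℂ)) ⟨?_, ?_⟩ le_rfl
      · simpa only [div_eq_mul_inv] using hf.1.mul_const _
      · refine (iInf₂_le (1 : ℝ) ⟨one_pos, ?_⟩).trans (by simp)
        refine le_trans (lintegral_mono fun x => ?_) hk1
        simp only [Complex.ofReal_one, div_one]
        exact ENNReal.ofReal_le_ofReal (compl_compl_le Φ _)
    refine le_trans (le_of_eq ?_) (mul_le_mul_right h2 _)
    rw [← lintegral_const_mul' _ _ ENNReal.ofReal_ne_top]
    refine lintegral_congr fun x => ?_
    rw [← ofReal_norm, ← ofReal_norm, ← ENNReal.ofReal_mul hk.le]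
    congr 1
    rw [norm_mul, norm_mul, norm_div, Complex.norm_real, Real.norm_eq_abs, abs_of_pos hk]
    field_simp
  refine ENNReal.le_of_forall_pos_le_add fun ε hε _ => ?_
  have hε' : (0 : ℝ≥0∞) < ε / (orliczNorm (compl Φ.toFun) μ g + 1) :=
    ENNReal.div_pos (by simpa using hε.ne') (ENNReal.add_ne_top.2 ⟨hg', by simp⟩)
  have hlt := ENNReal.lt_add_right hf' hε'.ne'
  conv_lhs at hlt => unfold luxNorm
  simp only [iInf_lt_iff] at hlt
  obtain ⟨k, hk, hk2⟩ := hlt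
  refine (key k hk).trans ((mul_le_mul_left hk2.le _).trans ?_)
  rw [add_mul]
  gcongr
  calc (ε : ℝ≥0∞) / (orliczNorm (compl Φ.toFun) μ g + 1) * orliczNorm (compl Φ.toFun) μ g
      ≤ ε / (orliczNorm (compl Φ.toFun) μ g + 1) * (orliczNorm (compl Φ.toFun) μ g + 1) := by
        gcongr; exact le_self_add
    _ = ε := ENNReal.div_mul_cancel (by simp) (ENNReal.add_ne_top.2 ⟨hg', by simp⟩)

lemma MemMorseTransue.const_mul {Φ : ℝ → ℝ} {f : G → ℂ} (hf : MemMorseTransue Φ μ f) {c : ℂ}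
    (hc : c ≠ 0) : MemMorseTransue Φ μ (fun x => c * f x) := by
  refine ⟨hf.1.const_mul c, fun a ha => ?_⟩
  refine lt_of_eq_of_lt ?_ (hf.2 (a * ‖c‖) (mul_pos ha (norm_pos_iff.2 hc)))
  simp [modular, mul_assoc]

/-- A bounded measurable function on a finite measure space is in the Morse–Transue space. -/
lemma memMorseTransue_of_bound [IsFiniteMeasure μ] {Φ : ℝ → ℝ} (hΦ : MonotoneOn Φ (Set.Ici 0))
    {f : G → ℂ} (hf : AEStronglyMeasurable f μ) {C : ℝ} (hC : ∀ x, ‖f x‖ ≤ C) :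
    MemMorseTransue Φ μ f := by
  refine ⟨hf, fun a ha => ?_⟩
  refine lt_of_le_of_lt (lintegral_mono (g := fun _ => ENNReal.ofReal (Φ (a * C))) fun x => ?_) ?_
  · have : ‖(a : ℂ) * f x‖ ≤ a * C := by
      rw [norm_mul, Complex.norm_real, Real.norm_eq_abs, abs_of_pos ha]
      exact mul_le_mul_of_nonneg_left (hC x) ha.le
    exact ENNReal.ofReal_le_ofReal
      (hΦ (norm_nonneg _) ((norm_nonneg _).trans this) this)
  · rw [lintegral_const]
    exact ENNReal.mul_lt_top ENNReal.ofReal_lt_top (measure_lt_top _ _)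

lemma zero_memMorseTransue (Φ : NFunction) : MemMorseTransue Φ.toFun μ (fun _ => 0) :=
  ⟨aestronglyMeasurable_const, fun a _ => by simp [modular, Φ.map_zero]⟩

lemma compl_zero (Φ : NFunction) : compl Φ.toFun 0 = 0 := by
  refine le_antisymm (csSup_le (Set.Nonempty.image _ ⟨0, Set.self_mem_Ici⟩) ?_) ?_
  · rintro _ ⟨x, _, rfl⟩
    have := Φ.nonneg x
    simp only [abs_zero, mul_zero]
    linarith
  · have := young Φ le_rfl 0
    simpa [Φ.map_zero] using this

lemma zero_memMorseTransue_compl (Φ : NFunction) :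
    MemMorseTransue (compl Φ.toFun) μ (fun _ => 0) :=
  ⟨aestronglyMeasurable_const, fun a _ => by simp [modular, compl_zero]⟩

end Orlicz

/-! ### Banach algebras, approximate identities and amenability -/

namespace BanachAlg

/-- `A` is a (not necessarily unital) complex Banach algebra: a complex Banach space with an
associative bilinear product which is bounded, i.e. `‖a b‖ ≤ C ‖a‖ ‖b‖` for some constant `C`
(so that after passing to an equivalent norm one may take `C = 1`). -/
class IsBanachAlgebra (A : Type u) [NormedAddCommGroup A] [NormedSpace ℂ A] [Mul A] : Prop where
  complete : CompleteSpace A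
  mul_assoc : ∀ a b c : A, a * b * c = a * (b * c)
  add_mul : ∀ a b c : A, (a + b) * c = a * c + b * c
  mul_add : ∀ a b c : A, a * (b + c) = a * b + a * c
  smul_mul : ∀ (r : ℂ) (a b : A), (r • a) * b = r • (a * b)
  mul_smul : ∀ (r : ℂ) (a b : A), a * (r • b) = r • (a * b)
  bound : ∃ C : ℝ, ∀ a b : A, ‖a * b‖ ≤ C * ‖a‖ * ‖b‖

variable (A : Type u) [NormedAddCommGroup A] [NormedSpace ℂ A] [Mul A]

/-- `A` has a bounded (two-sided) approximate identity: a bounded net `(e_i)`, indexed by a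
nonempty directed set, with `a e_i → a` and `e_i a → a` for every `a`. -/
def HasBoundedApproximateIdentity [IsBanachAlgebra A] : Prop :=
  ∃ (ι : Type u) (_ : Preorder ι) (_ : IsDirectedOrder ι) (_ : Nonempty ι) (e : ι → A),
    (∃ C : ℝ, ∀ i, ‖e i‖ ≤ C) ∧
    ∀ a : A, Tendsto (fun i => a * e i) atTop (𝓝 a) ∧ Tendsto (fun i => e i * a) atTop (𝓝 a)

/-- `A` has a two-sided multiplicative identity. -/
def IsUnital [IsBanachAlgebra A] : Prop :=
  ∃ e : A, ∀ a : A, e * a = a ∧ a * e = a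

/-- A Banach `A`-bimodule structure on a Banach space `E`: commuting bounded left and right
actions; `lsmul a x` is `a · x` and `rsmul a x` is `x · a`. -/
structure BanachBimodule (E : Type u) [NormedAddCommGroup E] [NormedSpace ℂ E] where
  lsmul : A →L[ℂ] E →L[ℂ] E
  rsmul : A →L[ℂ] E →L[ℂ] E
  lsmul_mul : ∀ (a b : A) (x : E), lsmul (a * b) x = lsmul a (lsmul b x)
  rsmul_mul : ∀ (a b : A) (x : E), rsmul (a * b) x = rsmul b (rsmul a x)
  lsmul_rsmul : ∀ (a b : A) (x : E), lsmul a (rsmul b x) = rsmul b (lsmul a x)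

variable {A} {E : Type u} [NormedAddCommGroup E] [NormedSpace ℂ E]

/-- The dual bimodule `E*`: `(a · φ)(x) = φ(x · a)` and `(φ · a)(x) = φ(a · x)`. -/
def BanachBimodule.dual (M : BanachBimodule A E) : BanachBimodule A (E →L[ℂ] ℂ) where
  lsmul := (ContinuousLinearMap.compL ℂ E E ℂ).flip.comp M.rsmul
  rsmul := (ContinuousLinearMap.compL ℂ E E ℂ).flip.comp M.lsmul
  lsmul_mul a b φ := by ext x; simp [M.rsmul_mul]
  rsmul_mul a b φ := by ext x; simp [M.lsmul_mul]
  lsmul_rsmul a b φ := by ext x; simp [M.lsmul_rsmul]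

/-- A bounded linear map `D : A → E` is a derivation if `D (a b) = a · D b + D a · b`. -/
def BanachBimodule.IsDerivation (M : BanachBimodule A E) (D : A →L[ℂ] E) : Prop :=
  ∀ a b : A, D (a * b) = M.lsmul a (D b) + M.rsmul b (D a)

/-- `D : A → E` is inner if there is `x` in `E` with `D a = a · x - x · a` for all `a`. -/
def BanachBimodule.IsInner (M : BanachBimodule A E) (D : A →L[ℂ] E) : Prop :=
  ∃ x : E, ∀ a : A, D a = M.lsmul a x - M.rsmul a x

variable (A) in
/-- `A` is amenable (Johnson): for every Banach `A`-bimodule `E`, every bounded derivation from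
`A` into the dual bimodule `E*` is inner. -/
def IsAmenable [IsBanachAlgebra A] : Prop :=
  ∀ (E : Type u) [NormedAddCommGroup E] [NormedSpace ℂ E] [CompleteSpace E]
    (M : BanachBimodule A E) (D : A →L[ℂ] (E →L[ℂ] ℂ)),
    M.dual.IsDerivation D → M.dual.IsInner D

end BanachAlg

/-! ### The Figà-Talamanca–Herz–Orlicz algebra -/

namespace Orlicz

variable {G : Type u} [Group G]

/-- `ǧ(x) = g(x⁻¹)`. -/
def check (g : G → ℂ) (x : G) : ℂ := g x⁻¹

variable [MeasurableSpace G]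

/-- The convolution `(f * g)(x) = ∫ f(y) g(y⁻¹ x) dμ(y)`. -/
def conv (μ : Measure G) (f g : G → ℂ) (x : G) : ℂ := ∫ y, f y * g (y⁻¹ * x) ∂μ

variable [TopologicalSpace G]

/-- The sequences `f` in `M^Φ` and `g` in `M^Ψ` (`Ψ` complementary to `Φ`) satisfy
`∑ N_Φ(f_n) ‖g_n‖_Ψ < ∞` and represent `u = ∑ f_n * ǧ_n`. -/
structure IsRep (Φ : NFunction) (μ : Measure G) (u : C₀(G, ℂ)) (f g : ℕ → G → ℂ) : Prop where
  left_mem : ∀ n, MemMorseTransue Φ.toFun μ (f n)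
  right_mem : ∀ n, MemMorseTransue (compl Φ.toFun) μ (g n)
  cost_lt : ∑' n, luxNorm Φ.toFun μ (f n) * orliczNorm (compl Φ.toFun) μ (g n) < ∞
  hasSum : ∀ x, HasSum (fun n => conv μ (f n) (check (g n)) x) (u x)

/-- The infimum of `∑ N_Φ(f_n) ‖g_n‖_Ψ` over all representations `u = ∑ f_n * ǧ_n`
(`∞` if there is none). -/
def repNorm (Φ : NFunction) (μ : Measure G) (u : C₀(G, ℂ)) : ℝ≥0∞ :=
  ⨅ (f : ℕ → G → ℂ) (g : ℕ → G → ℂ) (_ : IsRep Φ μ u f g),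
    ∑' n, luxNorm Φ.toFun μ (f n) * orliczNorm (compl Φ.toFun) μ (g n)

variable {Φ : NFunction} {μ : Measure G}

lemma repNorm_lt_top_iff {u : C₀(G, ℂ)} : repNorm Φ μ u < ∞ ↔ ∃ f g, IsRep Φ μ u f g := by
  constructor
  · intro h
    simp only [repNorm, iInf_lt_iff] at h
    obtain ⟨f, g, h, -⟩ := h
    exact ⟨f, g, h⟩
  · rintro ⟨f, g, h⟩
    exact lt_of_le_of_lt (iInf_le_of_le f (iInf_le_of_le g (iInf_le _ h))) h.cost_lt

lemma repNorm_le {u : C₀(G, ℂ)} {f g : ℕ → G → ℂ} (h : IsRep Φ μ u f g) : repNorm Φ μ u ≤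
    ∑' n, luxNorm Φ.toFun μ (f n) * orliczNorm (compl Φ.toFun) μ (g n) :=
  iInf_le_of_le f (iInf_le_of_le g (iInf_le _ h))

lemma conv_zero (f : G → ℂ) (x : G) : conv μ f (check fun _ => 0) x = 0 := by
  simp [conv, check]

lemma repNorm_zero : repNorm Φ μ (0 : C₀(G, ℂ)) = 0 := by
  have h0 : ∑' _ : ℕ, luxNorm Φ.toFun μ (fun _ => 0) *
      orliczNorm (compl Φ.toFun) μ (fun _ => 0) = 0 := by simp [orliczNorm_zero]
  refine le_antisymm (le_trans (repNorm_le (f := fun _ _ => 0) (g := fun _ _ => 0)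
    ⟨fun _ => zero_memMorseTransue Φ, fun _ => zero_memMorseTransue_compl Φ, ?_, fun x => ?_⟩)
    h0.le) bot_le
  · rw [h0]; simp
  · simp only [conv_zero]; exact hasSum_zero

lemma repNorm_smul_le {c : ℂ} (hc : c ≠ 0) (u : C₀(G, ℂ)) :
    repNorm Φ μ (c • u) ≤ ‖c‖ₑ * repNorm Φ μ u := by
  have hc0 : ‖c‖ₑ ≠ 0 := by simpa using hc
  conv_rhs => unfold repNorm
  rw [ENNReal.mul_iInf_of_ne hc0 (by simp)]
  refine le_iInf fun f => ?_
  rw [ENNReal.mul_iInf_of_ne hc0 (by simp)]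
  refine le_iInf fun g => ?_
  rw [ENNReal.mul_iInf_of_ne hc0 (by simp)]
  refine le_iInf fun h => ?_
  have hle : ∑' n, luxNorm Φ.toFun μ (fun x => c * f n x) *
      orliczNorm (compl Φ.toFun) μ (g n) ≤
      ‖c‖ₑ * ∑' n, luxNorm Φ.toFun μ (f n) * orliczNorm (compl Φ.toFun) μ (g n) := by
    rw [← ENNReal.tsum_mul_left]
    refine ENNReal.tsum_le_tsum fun n => ?_
    rw [← mul_assoc]
    gcongr
    exact luxNorm_const_mul_le _ _ hc
  refine (repNorm_le ⟨fun n => (h.left_mem n).const_mul hc, h.right_mem, ?_, fun x => ?_⟩).trans hle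
  · exact hle.trans_lt (ENNReal.mul_lt_top (by simp) h.cost_lt)
  · have := (h.hasSum x).mul_left c
    simpa [conv, mul_assoc, integral_const_mul] using this

variable [IsTopologicalGroup G] [BorelSpace G] [μ.IsHaarMeasure]

lemma lintegral_conv_le {f g : G → ℂ} (hf : MemMorseTransue Φ.toFun μ f)
    (hg : MemMorseTransue (compl Φ.toFun) μ g) (x : G) :
    ∫⁻ y, ‖f y * check g (y⁻¹ * x)‖ₑ ∂μ
      ≤ luxNorm Φ.toFun μ f * orliczNorm (compl Φ.toFun) μ g := by
  have hmod : ∀ h : G → ℂ, modular Φ.toFun μ (fun y => h (x * y)) = modular Φ.toFun μ h :=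
    fun h => lintegral_mul_left_eq_self (μ := μ) (fun y => ENNReal.ofReal (Φ.toFun ‖h y‖)) x
  have hf' : MemMorseTransue Φ.toFun μ (fun y => f (x * y)) :=
    ⟨hf.1.comp_measurePreserving (measurePreserving_mul_left μ x), fun a ha => by
      rw [hmod fun y => (a : ℂ) * f y]; exact hf.2 a ha⟩
  have hl : luxNorm Φ.toFun μ (fun y => f (x * y)) = luxNorm Φ.toFun μ f := by
    unfold luxNorm
    refine iInf_congr fun k => ?_
    rw [hmod fun y => f y / (k : ℂ)]
  rw [← hl, ← lintegral_mul_left_eq_self (μ := μ) _ x]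
  simpa [check, mul_assoc] using holder Φ hf' hg

lemma norm_conv_le {f g : G → ℂ} (hf : MemMorseTransue Φ.toFun μ f)
    (hg : MemMorseTransue (compl Φ.toFun) μ g) (x : G) :
    ‖conv μ f (check g) x‖ₑ ≤ luxNorm Φ.toFun μ f * orliczNorm (compl Φ.toFun) μ g :=
  (enorm_integral_le_lintegral_enorm _).trans (lintegral_conv_le hf hg x)

lemma summable_of_enorm_le {ι : Type*} {a : ι → ℂ} {c : ι → ℝ≥0∞} (h : ∀ i, ‖a i‖ₑ ≤ c i)
    (hc : ∑' i, c i ≠ ∞) : Summable a ∧ ‖∑' i, a i‖ₑ ≤ ∑' i, c i := by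
  have hs := ENNReal.summable_toReal hc
  have hle : ∀ i, ‖a i‖ ≤ (c i).toReal := fun i => by
    rw [← toReal_enorm]
    exact ENNReal.toReal_mono (ENNReal.ne_top_of_tsum_ne_top hc i) (h i)
  refine ⟨Summable.of_norm_bounded hs hle, ?_⟩
  have := tsum_of_norm_bounded hs.hasSum hle
  rw [← ENNReal.tsum_toReal_eq (ENNReal.ne_top_of_tsum_ne_top hc)] at this
  rw [← ofReal_norm]
  exact (ENNReal.ofReal_le_ofReal this).trans (ENNReal.ofReal_toReal hc).le

lemma enorm_le_repNorm (u : C₀(G, ℂ)) (x : G) : ‖u x‖ₑ ≤ repNorm Φ μ u := by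
  refine le_iInf fun f => le_iInf fun g => le_iInf fun h => ?_
  have := (summable_of_enorm_le (fun n => norm_conv_le (h.left_mem n) (h.right_mem n) x)
    h.cost_lt.ne).2
  rwa [(h.hasSum x).tsum_eq] at this

/-- Countable subadditivity. -/
lemma repNorm_tsum_le {v : ℕ → C₀(G, ℂ)} {w : C₀(G, ℂ)}
    (hw : ∀ x, HasSum (fun k => v k x) (w x)) :
    repNorm Φ μ w ≤ ∑' k, repNorm Φ μ (v k) := by
  rcases eq_or_ne (∑' k, repNorm Φ μ (v k)) ∞ with htop | htop
  · rw [htop]; exact le_top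
  refine ENNReal.le_of_forall_pos_le_add fun ε hε _ => ?_
  obtain ⟨δ, hδ, hδε⟩ := ENNReal.exists_pos_sum_of_countable (ε := (ε : ℝ≥0∞))
    (by simpa using hε.ne') ℕ
  have hex : ∀ k, ∃ f g, IsRep Φ μ (v k) f g ∧
      ∑' n, luxNorm Φ.toFun μ (f n) * orliczNorm (compl Φ.toFun) μ (g n)
        ≤ repNorm Φ μ (v k) + δ k := by
    intro k
    have hlt := ENNReal.lt_add_right (ENNReal.ne_top_of_tsum_ne_top htop k)
      (b := (δ k : ℝ≥0∞)) (by simpa using (hδ k).ne')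
    conv_lhs at hlt => unfold repNorm
    simp only [iInf_lt_iff] at hlt
    obtain ⟨f, g, h, h'⟩ := hlt
    exact ⟨f, g, h, h'.le⟩
  choose f g hrep hcost using hex
  have hsum : ∑' p : ℕ × ℕ, luxNorm Φ.toFun μ (f p.1 p.2) *
      orliczNorm (compl Φ.toFun) μ (g p.1 p.2) ≤ (∑' k, repNorm Φ μ (v k)) + ε := by
    rw [ENNReal.tsum_prod']
    refine (ENNReal.tsum_le_tsum hcost).trans ?_
    rw [ENNReal.tsum_add]
    gcongr
  have hsum_lt : ∑' p : ℕ × ℕ, luxNorm Φ.toFun μ (f p.1 p.2) *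
      orliczNorm (compl Φ.toFun) μ (g p.1 p.2) < ∞ :=
    hsum.trans_lt (ENNReal.add_lt_top.2 ⟨htop.lt_top, by simp⟩)
  let e : ℕ ≃ ℕ × ℕ := Nat.pairEquiv.symm
  have hre : ∑' n, luxNorm Φ.toFun μ (f (e n).1 (e n).2) *
      orliczNorm (compl Φ.toFun) μ (g (e n).1 (e n).2) = ∑' p : ℕ × ℕ,
      luxNorm Φ.toFun μ (f p.1 p.2) * orliczNorm (compl Φ.toFun) μ (g p.1 p.2) :=
    e.tsum_eq fun p : ℕ × ℕ =>
      luxNorm Φ.toFun μ (f p.1 p.2) * orliczNorm (compl Φ.toFun) μ (g p.1 p.2)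
  refine (repNorm_le (f := fun n => f (e n).1 (e n).2) (g := fun n => g (e n).1 (e n).2)
    ⟨fun n => (hrep _).left_mem _, fun n => (hrep _).right_mem _, hre ▸ hsum_lt, fun x => ?_⟩).trans
    (hre ▸ hsum)
  have hS := (summable_of_enorm_le (fun p : ℕ × ℕ => norm_conv_le ((hrep p.1).left_mem p.2)
    ((hrep p.1).right_mem p.2) x) hsum_lt.ne).1
  have h1 := hS.hasSum
  have h2 := h1.prod_fiberwise fun k => (hrep k).hasSum x
  rw [h2.unique (hw x)] at h1
  exact (e.hasSum_iff (f := fun p : ℕ × ℕ => conv μ (f p.1 p.2) (check (g p.1 p.2)) x)).2 h1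

lemma repNorm_add_le (u v : C₀(G, ℂ)) :
    repNorm Φ μ (u + v) ≤ repNorm Φ μ u + repNorm Φ μ v := by
  let s : ℕ → C₀(G, ℂ) := fun n => if n = 0 then u else if n = 1 then v else 0
  have hs : ∀ n ∉ Finset.range 2, s n = 0 := by
    intro n hn
    simp only [Finset.mem_range, not_lt] at hn
    simp only [s]
    rw [if_neg (by omega), if_neg (by omega)]
  have h := repNorm_tsum_le (Φ := Φ) (μ := μ) (v := s) (w := u + v) fun x => by
    have := hasSum_sum_of_ne_finset_zero (f := fun n => s n x) (s := Finset.range 2)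
      (L := SummationFilter.unconditional ℕ) (fun n hn => by simp [hs n hn])
    simpa [Finset.sum_range_succ, s] using this
  rw [tsum_eq_sum (s := Finset.range 2) (fun n hn => by rw [hs n hn, repNorm_zero])] at h
  simpa [Finset.sum_range_succ, s] using h

variable (Φ μ) in
/-- The linear space of those `u` in `C₀(G)` that can be written `u = ∑ f_n * ǧ_n` with `f_n` in
`M^Φ`, `g_n` in `M^Ψ` and `∑ N_Φ(f_n) ‖g_n‖_Ψ < ∞`. -/
def herzSubmodule : Submodule ℂ C₀(G, ℂ) where
  carrier := {u | ∃ f g, IsRep Φ μ u f g}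
  zero_mem' := repNorm_lt_top_iff.1 (by rw [repNorm_zero]; simp)
  add_mem' ha hb := repNorm_lt_top_iff.1 ((repNorm_add_le _ _).trans_lt
    (ENNReal.add_lt_top.2 ⟨repNorm_lt_top_iff.2 ha, repNorm_lt_top_iff.2 hb⟩))
  smul_mem' c u hu := by
    rcases eq_or_ne c 0 with rfl | hc
    · rw [zero_smul]; exact repNorm_lt_top_iff.1 (by rw [repNorm_zero]; simp)
    · exact repNorm_lt_top_iff.1 ((repNorm_smul_le hc u).trans_lt
        (ENNReal.mul_lt_top (by simp) (repNorm_lt_top_iff.2 hu)))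

variable (Φ μ) in
/-- The space `A_Φ(G)`. It is a type of its own because it carries the norm `‖·‖_{A_Φ}` and not
the uniform norm of `C₀(G)`. -/
def HerzAlgebra : Type u := herzSubmodule Φ μ

namespace HerzAlgebra

instance : AddCommGroup (HerzAlgebra Φ μ) :=
  inferInstanceAs (AddCommGroup (herzSubmodule Φ μ))

instance : Module ℂ (HerzAlgebra Φ μ) :=
  inferInstanceAs (Module ℂ (herzSubmodule Φ μ))

/-- The inclusion of `A_Φ(G)` into `C₀(G)`. -/
def toC₀ : HerzAlgebra Φ μ →ₗ[ℂ] C₀(G, ℂ) := (herzSubmodule Φ μ).subtype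

lemma toC₀_injective : Function.Injective (toC₀ (Φ := Φ) (μ := μ)) :=
  Subtype.val_injective

lemma repNorm_ne_top (u : HerzAlgebra Φ μ) : repNorm Φ μ (toC₀ u) ≠ ∞ :=
  (repNorm_lt_top_iff.2 u.2).ne

lemma eq_zero_of_repNorm (u : HerzAlgebra Φ μ) (h : repNorm Φ μ (toC₀ u) = 0) : u = 0 := by
  apply toC₀_injective
  ext x
  have := enorm_le_repNorm (Φ := Φ) (μ := μ) (toC₀ u) x
  rw [h] at this
  simpa using this

lemma repNorm_neg_le (u : C₀(G, ℂ)) : repNorm Φ μ (-u) ≤ repNorm Φ μ u := by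
  have := repNorm_smul_le (Φ := Φ) (μ := μ) (c := -1) (by simp) u
  have he : (-1 : ℂ) • u = -u := by ext x; simp
  rw [he] at this
  simpa using this

/-- `A_Φ(G)` is normed by `‖u‖ = inf ∑ N_Φ(f_n) ‖g_n‖_Ψ`. -/
instance : NormedAddCommGroup (HerzAlgebra Φ μ) :=
  AddGroupNorm.toNormedAddCommGroup
    { toFun := fun u => (repNorm Φ μ (toC₀ u)).toReal
      map_zero' := by simp [repNorm_zero]
      add_le' := fun u v => by
        rw [← ENNReal.toReal_add (repNorm_ne_top u) (repNorm_ne_top v), map_add]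
        exact ENNReal.toReal_mono
          (ENNReal.add_ne_top.2 ⟨repNorm_ne_top u, repNorm_ne_top v⟩) (repNorm_add_le _ _)
      neg' := fun u => by
        rw [map_neg]
        congr 1
        refine le_antisymm (repNorm_neg_le _) ?_
        conv_lhs => rw [← neg_neg (toC₀ u)]
        exact repNorm_neg_le _
      eq_zero_of_map_eq_zero' := fun u h => by
        rcases (ENNReal.toReal_eq_zero_iff _).1 h with h | h
        · exact eq_zero_of_repNorm u h
        · exact absurd h (repNorm_ne_top u) }

lemma norm_def (u : HerzAlgebra Φ μ) : ‖u‖ = (repNorm Φ μ (toC₀ u)).toReal := rfl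

lemma enorm_def (u : HerzAlgebra Φ μ) : ‖u‖ₑ = repNorm Φ μ (toC₀ u) := by
  rw [← ofReal_norm, norm_def, ENNReal.ofReal_toReal (repNorm_ne_top u)]

instance : NormedSpace ℂ (HerzAlgebra Φ μ) where
  norm_smul_le c u := by
    rcases eq_or_ne c 0 with rfl | hc
    · simp
    · rw [norm_def, norm_def, map_smul, ← toReal_enorm, ← ENNReal.toReal_mul]
      exact ENNReal.toReal_mono (ENNReal.mul_ne_top (by simp) (repNorm_ne_top u))
        (repNorm_smul_le hc _)

lemma norm_toC₀_le (u : HerzAlgebra Φ μ) : ‖toC₀ u‖ ≤ ‖u‖ := by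
  refine (BoundedContinuousFunction.norm_le (f := (toC₀ u).toBCF) (norm_nonneg _)).2 fun x => ?_
  rw [← enorm_le_iff_norm_le, enorm_def]
  exact enorm_le_repNorm _ _

instance : CompleteSpace (HerzAlgebra Φ μ) := by
  refine NormedAddCommGroup.completeSpace_of_summable_imp_tendsto fun u hu => ?_
  have hs : Summable fun k => toC₀ (u k) :=
    Summable.of_norm_bounded hu fun k => norm_toC₀_le (u k)
  have hu' : ∑' k, repNorm Φ μ (toC₀ (u k)) ≠ ∞ := by
    simp only [← enorm_def, ← ofReal_norm]
    exact hu.tsum_ofReal_ne_top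
  have hpt : ∀ (x : G), HasSum (fun k => toC₀ (u k) x) ((∑' k, toC₀ (u k)) x) := fun x => by
    have hx : Continuous fun w : C₀(G, ℂ) => w x :=
      (BoundedContinuousFunction.lipschitz_eval_const x).continuous.comp
        (ZeroAtInftyContinuousMap.isometry_toBCF (α := G) (β := ℂ)).continuous
    let φ : C₀(G, ℂ) →+ ℂ := { toFun := fun w => w x, map_zero' := rfl, map_add' := fun _ _ => rfl }
    exact hs.hasSum.map φ hx
  let a : HerzAlgebra Φ μ := ⟨∑' k, toC₀ (u k), repNorm_lt_top_iff.1
    ((repNorm_tsum_le hpt).trans_lt hu'.lt_top)⟩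
  refine ⟨a, ?_⟩
  rw [tendsto_iff_norm_sub_tendsto_zero]
  have htail : ∀ n, ‖∑ i ∈ Finset.range n, u i - a‖ ≤
      (∑' k, repNorm Φ μ (toC₀ (u (k + n)))).toReal := by
    intro n
    rw [norm_sub_rev, norm_def]
    have hne : ∑' k, repNorm Φ μ (toC₀ (u (k + n))) ≠ ∞ :=
      ne_top_of_le_ne_top hu' (ENNReal.tsum_comp_le_tsum_of_injective (add_left_injective n) _)
    refine ENNReal.toReal_mono hne (repNorm_tsum_le fun x => ?_)
    have := (hasSum_nat_add_iff' n).2 (hpt x)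
    let φ : C₀(G, ℂ) →+ ℂ := { toFun := fun w => w x, map_zero' := rfl, map_add' := fun _ _ => rfl }
    have he : toC₀ (a - ∑ i ∈ Finset.range n, u i) x =
        (∑' k, toC₀ (u k)) x - ∑ i ∈ Finset.range n, toC₀ (u i) x := by
      rw [map_sub, map_sum, ZeroAtInftyContinuousMap.sub_apply]
      exact congrArg _ (map_sum φ _ _)
    rw [he]
    exact this
  refine squeeze_zero (fun _ => norm_nonneg _) htail ?_
  have := ENNReal.tendsto_sum_nat_add (fun k => repNorm Φ μ (toC₀ (u k))) hu'
  exact (ENNReal.tendsto_toReal ENNReal.zero_ne_top).comp this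

/-! #### The convolution product for compact groups -/

variable [CompactSpace G]

lemma continuous_conv {f g : G → ℂ} (hf : Continuous f) (hg : Continuous g) :
    Continuous (conv μ f g) := by
  rw [← continuousOn_univ]
  exact continuousOn_integral_of_compact_support (f := fun x y => f y * g (y⁻¹ * x))
    isCompact_univ (by fun_prop) (by simp)

variable (μ) in
/-- The convolution of two continuous functions on a compact group. -/
def convC₀ (u v : C₀(G, ℂ)) : C₀(G, ℂ) :=
  ZeroAtInftyContinuousMap.ContinuousMap.liftZeroAtInfty
    ⟨conv μ u v, continuous_conv u.continuous v.continuous⟩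

lemma convC₀_apply (u v : C₀(G, ℂ)) (x : G) : convC₀ μ u v x = conv μ u v x := rfl

lemma mem_of_continuous {u : G → ℂ} (hu : Continuous u) {F : ℝ → ℝ}
    (hF : MonotoneOn F (Set.Ici 0)) : MemMorseTransue F μ u := by
  have : Continuous fun x => ‖u x‖ := hu.norm
  obtain ⟨C, hC⟩ := (isCompact_range this).bddAbove
  have hm : AEStronglyMeasurable u μ :=
    (hu.stronglyMeasurable_of_hasCompactSupport
      (HasCompactSupport.of_compactSpace u)).aestronglyMeasurable
  exact memMorseTransue_of_bound hF hm fun x => hC ⟨x, rfl⟩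

lemma luxNorm_le_of_continuous {F : ℝ → ℝ} (hF : MonotoneOn F (Set.Ici 0)) {u : G → ℂ}
    {C : ℝ} (hC : 0 < C) (h : ∀ x, ‖u x‖ ≤ C) :
    luxNorm F μ u ≤ ENNReal.ofReal C * luxNorm F μ (fun _ => 1) := by
  have hC' : (C : ℂ) ≠ 0 := by exact_mod_cast hC.ne'
  refine (luxNorm_mono hF (g := fun _ => (C : ℂ) * 1) fun x => ?_).trans
    ((luxNorm_const_mul_le F (fun _ => 1) hC').trans (le_of_eq ?_))
  · simpa [abs_of_pos hC] using h x
  · rw [← ofReal_norm, Complex.norm_real, Real.norm_eq_abs, abs_of_pos hC]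

lemma orliczNorm_le_of_continuous (F : ℝ → ℝ) {u : G → ℂ}
    {C : ℝ} (hC : 0 < C) (h : ∀ x, ‖u x‖ ≤ C) :
    orliczNorm F μ u ≤ ENNReal.ofReal C * orliczNorm F μ (fun _ => 1) := by
  refine (orliczNorm_mono F (g := fun _ => (C : ℂ) * 1) fun x => ?_).trans
    ((orliczNorm_const_mul F (fun _ => 1) (C : ℂ)).trans ?_).le
  · simpa [abs_of_pos hC] using h x
  · rw [← ofReal_norm, Complex.norm_real, Real.norm_eq_abs, abs_of_pos hC]

lemma norm_apply_le (u : C₀(G, ℂ)) (x : G) : ‖u x‖ ≤ ‖u‖ :=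
  BoundedContinuousFunction.norm_coe_le_norm u.toBCF x

lemma repNorm_convC₀_le_mul (u v : C₀(G, ℂ)) : repNorm Φ μ (convC₀ μ u v) ≤
    luxNorm Φ.toFun μ u * orliczNorm (compl Φ.toFun) μ (check v) := by
  let f : ℕ → G → ℂ := fun n => if n = 0 then u else fun _ => 0
  let g : ℕ → G → ℂ := fun n => if n = 0 then check v else fun _ => 0
  have hcv : Continuous (check v : G → ℂ) := v.continuous.comp continuous_inv
  have hu := mem_of_continuous (μ := μ) u.continuous (monotoneOn Φ)
  have hv := mem_of_continuous (μ := μ) hcv (monotoneOn_compl Φ)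
  have hcost : ∑' n, luxNorm Φ.toFun μ (f n) * orliczNorm (compl Φ.toFun) μ (g n) =
      luxNorm Φ.toFun μ u * orliczNorm (compl Φ.toFun) μ (check v) := by
    rw [tsum_eq_single 0 fun n hn => by simp [f, g, hn, orliczNorm_zero]]
    simp [f, g]
  refine (repNorm_le (f := f) (g := g) ⟨fun n => ?_, fun n => ?_, ?_, fun x => ?_⟩).trans hcost.le
  · by_cases h : n = 0
    · simpa [f, h] using hu
    · simpa [f, h] using zero_memMorseTransue Φ
  · by_cases h : n = 0
    · simpa [g, h] using hv
    · simpa [g, h] using zero_memMorseTransue_compl Φ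
  · rw [hcost]
    exact ENNReal.mul_lt_top (luxNorm_ne_top Φ hu).lt_top (orliczNorm_compl_ne_top Φ hv).lt_top
  · have h0 : conv μ (f 0) (check (g 0)) x = convC₀ μ u v x := by
      simp [f, g, convC₀_apply, conv, check]
    rw [← h0]
    exact hasSum_single 0 fun n hn => by simp [g, hn, conv_zero]

variable (Φ μ) in
lemma exists_repNorm_convC₀_le : ∃ K : ℝ≥0∞, K ≠ ∞ ∧ ∀ u v : C₀(G, ℂ),
    repNorm Φ μ (convC₀ μ u v) ≤ K * ‖u‖ₑ * ‖v‖ₑ := by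
  refine ⟨luxNorm Φ.toFun μ (fun _ => 1) * orliczNorm (compl Φ.toFun) μ (fun _ => 1),
    ENNReal.mul_ne_top (luxNorm_ne_top Φ (mem_of_continuous continuous_const (monotoneOn Φ)))
      (orliczNorm_compl_ne_top Φ (mem_of_continuous continuous_const (monotoneOn_compl Φ))),
    fun u v => ?_⟩
  rcases eq_or_ne u 0 with rfl | hu
  · have : convC₀ μ 0 v = 0 := by ext x; simp [convC₀_apply, conv]
    rw [this, repNorm_zero]; simp
  rcases eq_or_ne v 0 with rfl | hv
  · have : convC₀ μ u 0 = 0 := by ext x; simp [convC₀_apply, conv]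
    rw [this, repNorm_zero]; simp
  refine (repNorm_convC₀_le_mul u v).trans ((mul_le_mul'
    (luxNorm_le_of_continuous (monotoneOn Φ) (norm_pos_iff.2 hu) (norm_apply_le u))
    (orliczNorm_le_of_continuous _ (norm_pos_iff.2 hv) fun x => norm_apply_le v x⁻¹)).trans
    (le_of_eq ?_))
  rw [ofReal_norm, ofReal_norm]
  ring

/-- On a compact group, the product on `A_Φ(G)` is convolution with respect to `μ`. -/
instance : Mul (HerzAlgebra Φ μ) where
  mul u v := ⟨convC₀ μ (toC₀ u) (toC₀ v), by
    obtain ⟨K, hK, h⟩ := exists_repNorm_convC₀_le Φ μ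
    exact repNorm_lt_top_iff.1 ((h _ _).trans_lt
      (ENNReal.mul_lt_top (ENNReal.mul_lt_top hK.lt_top (by simp)) (by simp)))⟩

lemma toC₀_mul (u v : HerzAlgebra Φ μ) : toC₀ (u * v) = convC₀ μ (toC₀ u) (toC₀ v) := rfl

lemma mul_apply (u v : HerzAlgebra Φ μ) (x : G) :
    toC₀ (u * v) x = ∫ y, toC₀ u y * toC₀ v (y⁻¹ * x) ∂μ := rfl

lemma integrable_conv (u v : C₀(G, ℂ)) (x : G) :
    Integrable (fun y => u y * v (y⁻¹ * x)) μ :=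
  Continuous.integrable_of_hasCompactSupport
    (u.continuous.mul (v.continuous.comp (by fun_prop))) (HasCompactSupport.of_compactSpace _)

lemma convC₀_assoc (u v w : C₀(G, ℂ)) :
    convC₀ μ (convC₀ μ u v) w = convC₀ μ u (convC₀ μ v w) := by
  ext x
  simp only [convC₀_apply, conv]
  have hu := u.continuous
  have hv := v.continuous
  have hw := w.continuous
  calc ∫ y, (∫ z, u z * v (z⁻¹ * y) ∂μ) * w (y⁻¹ * x) ∂μ
      = ∫ y, ∫ z, u z * v (z⁻¹ * y) * w (y⁻¹ * x) ∂μ ∂μ := by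
        simp only [integral_mul_const]
    _ = ∫ z, ∫ y, u z * v (z⁻¹ * y) * w (y⁻¹ * x) ∂μ ∂μ :=
        integral_integral_swap_of_hasCompactSupport
          (f := fun y z => u z * v (z⁻¹ * y) * w (y⁻¹ * x))
          (by
            simp only [Function.uncurry_def]
            exact ((hu.comp continuous_snd).mul (hv.comp (by fun_prop))).mul
              (hw.comp (by fun_prop)))
          (HasCompactSupport.of_compactSpace _)
    _ = ∫ z, u z * ∫ y, v y * w (y⁻¹ * (z⁻¹ * x)) ∂μ ∂μ := by
        refine integral_congr_ae (ae_of_all _ fun z => ?_)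
        simp only
        rw [← integral_const_mul, ← integral_mul_left_eq_self (μ := μ) _ z]
        simp [mul_assoc]

/-- For compact `G`, the space `A_Φ(G)` is a Banach algebra under convolution. -/
instance : BanachAlg.IsBanachAlgebra (HerzAlgebra Φ μ) where
  complete := inferInstance
  mul_assoc u v w := toC₀_injective (by simp only [toC₀_mul, convC₀_assoc])
  add_mul u v w := toC₀_injective (by
    ext x
    simp only [map_add, toC₀_mul, ZeroAtInftyContinuousMap.add_apply, convC₀_apply, conv, add_mul]
    exact integral_add (integrable_conv _ _ _) (integrable_conv _ _ _))
  mul_add u v w := toC₀_injective (by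
    ext x
    simp only [map_add, toC₀_mul, ZeroAtInftyContinuousMap.add_apply, convC₀_apply, conv, mul_add]
    exact integral_add (integrable_conv _ _ _) (integrable_conv _ _ _))
  smul_mul r u v := toC₀_injective (by
    ext x
    simp only [map_smul, toC₀_mul, ZeroAtInftyContinuousMap.smul_apply, convC₀_apply, conv,
      smul_eq_mul, mul_assoc, integral_const_mul])
  mul_smul r u v := toC₀_injective (by
    ext x
    simp only [map_smul, toC₀_mul, ZeroAtInftyContinuousMap.smul_apply, convC₀_apply, conv,
      smul_eq_mul, mul_left_comm _ r, integral_const_mul])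
  bound := by
    obtain ⟨K, hK, h⟩ := exists_repNorm_convC₀_le Φ μ
    refine ⟨K.toReal, fun u v => ?_⟩
    have h1 := ENNReal.toReal_mono (ENNReal.mul_ne_top (ENNReal.mul_ne_top hK (by simp)) (by simp))
      (h (toC₀ u) (toC₀ v))
    rw [ENNReal.toReal_mul, ENNReal.toReal_mul, toReal_enorm, toReal_enorm] at h1
    rw [norm_def (u * v), toC₀_mul]
    refine h1.trans ?_
    gcongr
    · exact norm_toC₀_le u
    · exact norm_toC₀_le v

end HerzAlgebra

end Orlicz

end

/-!
Write `A = A_Φ(G)`. Everything rests on the estimate `|(u * v)(1)| ≤ ‖v‖ ∫ |u|`, which holds because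
the uniform norm is dominated by the norm of `A`.

A bounded approximate identity turns the estimate into `|u(1)| ≤ C ∫ |u|` for all `u` in `A`
(`norm_apply_one_le_of_hasBoundedApproximateIdentity`). So does amenability: make `A*` a bimodule
with zero left action and right action `φ · a = φ(a ·)`; the canonical embedding `A → A**` is then a
derivation, and a functional `x` on `A*` implementing it satisfies `x(φ · a) = φ(a)`
(`BanachAlg.IsAmenable.exists_bidual`), which is applied to `φ = ` evaluation at `1`.
Such an inequality forces `G` to be finite (`finite_of_norm_apply_one_le`): otherwise points are
null sets, and for a symmetric bump function `p` supported in an open set `V` of small measure the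
function `u = p * p` has `u(1) = ∫ p²` but `∫ |u| = (∫ p)² ≤ μ(V) ∫ p²`.

Conversely, for finite `G` the normalized point masses `s g = δ_g / μ{1}` lie in `A`, span it, and
multiply as the elements of `G`. Hence `s 1` is an identity, and averaging a derivation over `G`
shows that it is inner (`BanachAlg.isAmenable_of_span`).
-/

open MeasureTheory Filter Topology
open scoped ENNReal ZeroAtInfty

noncomputable section

/-! ### Amenable Banach algebras and algebras spanned by a finite group -/

namespace BanachAlg

variable {A : Type u} [NormedAddCommGroup A] [NormedSpace ℂ A] [Mul A]

lemma IsUnital.hasBoundedApproximateIdentity [IsBanachAlgebra A] (h : IsUnital A) :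
    HasBoundedApproximateIdentity A := by
  obtain ⟨e, he⟩ := h
  refine ⟨PUnit, inferInstance, inferInstance, inferInstance, fun _ => e, ⟨‖e‖, fun _ => le_rfl⟩,
    fun a => ?_⟩
  simp only [he]
  exact ⟨tendsto_const_nhds, tendsto_const_nhds⟩

variable (A) in
/-- The product of a Banach algebra as a bounded bilinear map. -/
def mulL [IsBanachAlgebra A] : A →L[ℂ] A →L[ℂ] A :=
  LinearMap.mkContinuous₂
    (LinearMap.mk₂ ℂ (fun a b : A => a * b) IsBanachAlgebra.add_mul IsBanachAlgebra.smul_mul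
      IsBanachAlgebra.mul_add IsBanachAlgebra.mul_smul)
    (IsBanachAlgebra.bound (A := A)).choose (IsBanachAlgebra.bound (A := A)).choose_spec

lemma mulL_apply [IsBanachAlgebra A] (a b : A) : mulL A a b = a * b := rfl

variable (A) in
/-- The dual space `A*` as a bimodule with right action `(φ · a)(b) = φ(a b)` and zero left
action. -/
def dualRightModule [IsBanachAlgebra A] : BanachBimodule A (A →L[ℂ] ℂ) where
  lsmul := 0
  rsmul := (ContinuousLinearMap.compL ℂ A A ℂ).flip.comp (mulL A)
  lsmul_mul a b φ := by simp
  rsmul_mul a b φ := by ext x; simp [mulL_apply, IsBanachAlgebra.mul_assoc]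
  lsmul_rsmul a b φ := by simp

/-- The bidual of an amenable Banach algebra contains a right identity `x` for the action of the
algebra: `x(φ(a ·)) = φ(a)`. -/
lemma IsAmenable.exists_bidual [IsBanachAlgebra A] (h : IsAmenable A) :
    ∃ x : (A →L[ℂ] ℂ) →L[ℂ] ℂ, ∀ (a : A) (φ : A →L[ℂ] ℂ), x (φ.comp (mulL A a)) = φ a := by
  obtain ⟨x, hx⟩ := h (A →L[ℂ] ℂ) (dualRightModule A) (ContinuousLinearMap.apply ℂ ℂ) (by
    intro a b
    ext φ
    simp [BanachBimodule.dual, dualRightModule, mulL_apply])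
  refine ⟨x, fun a φ => ?_⟩
  have := congrArg (fun T : (A →L[ℂ] ℂ) →L[ℂ] ℂ => T φ) (hx a)
  simpa [BanachBimodule.dual, dualRightModule] using this.symm

variable {G : Type*} [Group G]

lemma isUnital_of_span [IsBanachAlgebra A] {s : G → A} (hmul : ∀ g h, s g * s h = s (g * h))
    (hspan : Submodule.span ℂ (Set.range s) = ⊤) : IsUnital A := by
  refine ⟨s 1, fun a => ?_⟩
  have h1 : mulL A (s 1) = ContinuousLinearMap.id ℂ A :=
    ContinuousLinearMap.coe_injective <| LinearMap.ext_on_range hspan fun g => by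
      simp [mulL_apply, hmul]
  have h2 : (mulL A).flip (s 1) = ContinuousLinearMap.id ℂ A :=
    ContinuousLinearMap.coe_injective <| LinearMap.ext_on_range hspan fun g => by
      simp [mulL_apply, hmul]
  exact ⟨congrArg (fun T : A →L[ℂ] A => T a) h1, congrArg (fun T : A →L[ℂ] A => T a) h2⟩

/-- A derivation on an algebra spanned by a finite group is inner. The average
`φ = |G|⁻¹ ∑ s g · D (s g⁻¹)` satisfies `a · φ - φ · a = e · D a` with `e = s 1`; as `e` need not
act as the identity on `E`, the term `D e - e · D e` corrects the difference. -/
lemma BanachBimodule.isInner_of_span [Finite G] {s : G → A}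
    (hmul : ∀ g h, s g * s h = s (g * h)) (hspan : Submodule.span ℂ (Set.range s) = ⊤)
    {E : Type u} [NormedAddCommGroup E] [NormedSpace ℂ E] (M : BanachBimodule A E)
    {D : A →L[ℂ] E} (hD : M.IsDerivation D) : M.IsInner D := by
  have := Fintype.ofFinite G
  set φ : E := (Fintype.card G : ℂ)⁻¹ • ∑ g, M.lsmul (s g) (D (s g⁻¹)) with hφ
  have hcard : (Fintype.card G : ℂ) ≠ 0 := by exact_mod_cast Fintype.card_ne_zero
  have hl : ∀ g h x, M.lsmul (s g) (M.lsmul (s h) x) = M.lsmul (s (g * h)) x := fun g h x => by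
    rw [← M.lsmul_mul, hmul]
  have key : ∀ h, M.lsmul (s h) φ = M.lsmul (s 1) (D (s h)) + M.rsmul (s h) φ := by
    intro h
    have hsum : ∑ g, M.lsmul (s (h * g)) (D (s g⁻¹)) =
        ∑ g, M.lsmul (s g) (D (s g⁻¹ * s h)) :=
      Fintype.sum_equiv (Equiv.mulLeft h) _ _ fun g => by simp [hmul]
    simp only [hφ, map_smul, map_sum, hl, hsum, hD _ (s h), map_add, Finset.sum_add_distrib,
      mul_inv_cancel, M.lsmul_rsmul, smul_add]
    simp [← Nat.cast_smul_eq_nsmul ℂ, smul_smul, hcard]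
  refine ⟨φ - D (s 1) + M.lsmul (s 1) (D (s 1)), fun a => ?_⟩
  have hlin : D = M.lsmul.flip (φ - D (s 1) + M.lsmul (s 1) (D (s 1))) -
      M.rsmul.flip (φ - D (s 1) + M.lsmul (s 1) (D (s 1))) := by
    refine ContinuousLinearMap.coe_injective <| LinearMap.ext_on_range hspan fun h => ?_
    have h1 : D (s h) = M.lsmul (s 1) (D (s h)) + M.rsmul (s h) (D (s 1)) := by
      rw [← hD, hmul, one_mul]
    have h2 : M.lsmul (s 1) (M.rsmul (s h) (D (s 1))) = 0 := by
      have := congrArg (M.lsmul (s 1)) h1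
      rw [map_add, hl, one_mul] at this
      simpa using this
    change D (s h) = M.lsmul (s h) (φ - D (s 1) + M.lsmul (s 1) (D (s 1))) -
      M.rsmul (s h) (φ - D (s 1) + M.lsmul (s 1) (D (s 1)))
    simp only [map_add, map_sub, hl, mul_one, key, ← M.lsmul_rsmul, h2]
    conv_lhs => rw [h1]
    abel
  exact congrArg (fun T : A →L[ℂ] E => T a) hlin

lemma isAmenable_of_span [IsBanachAlgebra A] [Finite G] {s : G → A}
    (hmul : ∀ g h, s g * s h = s (g * h)) (hspan : Submodule.span ℂ (Set.range s) = ⊤) :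
    IsAmenable A :=
  fun _ _ _ _ M _ hD => M.dual.isInner_of_span hmul hspan hD

end BanachAlg

namespace Orlicz.HerzAlgebra

variable {G : Type u} [Group G] [TopologicalSpace G] [IsTopologicalGroup G]
  [CompactSpace G] [MeasurableSpace G] [BorelSpace G]
  {Φ : NFunction} {μ : Measure G} [μ.IsHaarMeasure]

variable (Φ μ) in
/-- The convolution of two continuous functions as an element of `A_Φ(G)`. -/
def ofConv (u v : C₀(G, ℂ)) : HerzAlgebra Φ μ :=
  ⟨convC₀ μ u v, by
    obtain ⟨K, hK, h⟩ := exists_repNorm_convC₀_le Φ μ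
    exact repNorm_lt_top_iff.1 ((h _ _).trans_lt
      (ENNReal.mul_lt_top (ENNReal.mul_lt_top hK.lt_top (by simp)) (by simp)))⟩

lemma toC₀_ofConv (u v : C₀(G, ℂ)) : toC₀ (ofConv Φ μ u v) = convC₀ μ u v := rfl

/-! ### Evaluation at the identity element -/

lemma norm_mul_apply_one_le (u v : HerzAlgebra Φ μ) :
    ‖toC₀ (u * v) 1‖ ≤ ‖v‖ * ∫ y, ‖toC₀ u y‖ ∂μ := by
  rw [mul_apply, mul_comm, ← integral_mul_const]
  refine norm_integral_le_of_norm_le ?_ (ae_of_all _ fun y => ?_)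
  · exact Continuous.integrable_of_hasCompactSupport
      ((toC₀ u).continuous.norm.mul continuous_const) (HasCompactSupport.of_compactSpace _)
  · rw [norm_mul]
    gcongr
    exact (norm_apply_le _ _).trans (norm_toC₀_le v)

variable (Φ μ) in
/-- Evaluation at `1` as a bounded functional on `A_Φ(G)`. -/
def evalOne : HerzAlgebra Φ μ →L[ℂ] ℂ :=
  LinearMap.mkContinuous
    { toFun := fun u => toC₀ u 1
      map_add' := fun u v => by rw [map_add]; rfl
      map_smul' := fun c u => by rw [map_smul]; rfl }
    1 fun u => by simpa using (norm_apply_le _ _).trans (norm_toC₀_le u)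

lemma evalOne_apply (u : HerzAlgebra Φ μ) : evalOne Φ μ u = toC₀ u 1 := rfl

lemma norm_apply_one_le_of_hasBoundedApproximateIdentity
    (h : BanachAlg.HasBoundedApproximateIdentity (HerzAlgebra Φ μ)) :
    ∃ C : ℝ, ∀ u : HerzAlgebra Φ μ, ‖toC₀ u 1‖ ≤ C * ∫ y, ‖toC₀ u y‖ ∂μ := by
  obtain ⟨ι, _, _, _, e, ⟨C, hC⟩, he⟩ := h
  refine ⟨C, fun u => ?_⟩
  have hlim := (((evalOne Φ μ).continuous.tendsto u).comp (he u).1).norm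
  refine le_of_tendsto hlim (Eventually.of_forall fun i => ?_)
  refine (norm_mul_apply_one_le u (e i)).trans ?_
  gcongr
  exact hC i

lemma norm_apply_one_le_of_isAmenable (h : BanachAlg.IsAmenable (HerzAlgebra Φ μ)) :
    ∃ C : ℝ, ∀ u : HerzAlgebra Φ μ, ‖toC₀ u 1‖ ≤ C * ∫ y, ‖toC₀ u y‖ ∂μ := by
  obtain ⟨x, hx⟩ := h.exists_bidual
  refine ⟨‖x‖, fun u => ?_⟩
  rw [← evalOne_apply, ← hx]
  refine (x.le_opNorm _).trans ?_
  gcongr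
  refine ContinuousLinearMap.opNorm_le_bound _ (integral_nonneg fun _ => norm_nonneg _) fun v => ?_
  rw [mul_comm]
  exact norm_mul_apply_one_le u v

/-- In an infinite compact group the identity element has neighbourhoods of arbitrarily small
Haar measure, each of which supports a symmetric bump function. -/
lemma exists_symmetric_bump [T2Space G] [μ.Regular] [Infinite G] {ε : ℝ} (hε : 0 < ε) :
    ∃ (V : Set G) (p : G → ℝ), IsOpen V ∧ μ.real V < ε ∧ Continuous p ∧ (∀ x, 0 ≤ p x) ∧
      (∀ x ∉ V, p x = 0) ∧ (∀ x, p x⁻¹ = p x) ∧ p 1 ≠ 0 := by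
  have hne : (𝓝[≠] (1 : G)).NeBot := by
    rw [neBot_iff]
    intro hbot
    have := discreteTopology_of_isOpen_singleton_one
      ((isOpen_singleton_iff_punctured_nhds 1).2 hbot)
    exact not_finite_iff_infinite.2 ‹_› (finite_of_compact_of_discrete (X := G))
  have h0 : μ {(1 : G)} < ENNReal.ofReal ε := by simpa using hε
  obtain ⟨V, h1V, hV, hμV⟩ := Set.exists_isOpen_lt_of_lt _ _ h0
  obtain ⟨f, hf0, hf1, hf⟩ := exists_continuous_zero_one_of_isClosed hV.isClosed_compl
    (isClosed_singleton (x := (1 : G)))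
    (Set.disjoint_left.2 fun x hx h1 => hx (h1V h1))
  refine ⟨V, fun x => f x * f x⁻¹, hV, ?_, by fun_prop, fun x => ?_, fun x hx => ?_,
    fun x => ?_, ?_⟩
  · rwa [← ENNReal.ofReal_lt_ofReal_iff hε, ofReal_measureReal]
  · exact mul_nonneg (hf x).1 (hf _).1
  · simp [hf0 hx]
  · simp [mul_comm]
  · simp [hf1 (Set.mem_singleton (1 : G))]

lemma finite_of_norm_apply_one_le [T2Space G] [μ.Regular]
    (h : ∃ C : ℝ, ∀ u : HerzAlgebra Φ μ, ‖toC₀ u 1‖ ≤ C * ∫ y, ‖toC₀ u y‖ ∂μ) : Finite G := by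
  by_contra hinf
  rw [not_finite_iff_infinite] at hinf
  obtain ⟨C, hC⟩ := h
  obtain ⟨V, p, hV, hμV, hp, hp0, hpV, hsymm, hp1⟩ :=
    exists_symmetric_bump (μ := μ) (ε := (|C| + 1)⁻¹) (by positivity)
  have hint : ∀ {q : G → ℝ}, Continuous q → Integrable q μ := fun hq =>
    hq.integrable_of_hasCompactSupport (HasCompactSupport.of_compactSpace _)
  set a := ∫ x, p x ∂μ with ha
  set b := ∫ x, p x * p x ∂μ with hb
  set m := μ.real V with hm
  have hb0 : 0 < b :=
    (hp.mul hp).integral_pos_of_hasCompactSupport_nonneg_nonzero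
      (HasCompactSupport.of_compactSpace _) (fun x => mul_nonneg (hp0 x) (hp0 x))
      (mul_ne_zero hp1 hp1)
  have hm0 : 0 < m := by
    refine ENNReal.toReal_pos (hV.measure_pos μ ⟨1, ?_⟩).ne' (measure_ne_top _ _)
    by_contra h1
    exact hp1 (hpV 1 h1)
  -- Cauchy–Schwarz, from integrating `2 t p ≤ p² + t² 1_V` with `t = a / m`.
  have hcs : a ^ 2 ≤ m * b := by
    have hle : ∫ x, 2 * (a / m) * p x ∂μ ≤
        ∫ x, (p x * p x + V.indicator (fun _ => (a / m) ^ 2) x) ∂μ := by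
      refine integral_mono ((hint hp).const_mul _) ((hint (hp.mul hp)).add
        ((integrable_const _).indicator hV.measurableSet)) fun x => ?_
      by_cases hx : x ∈ V
      · simp only [Set.indicator_of_mem hx]
        nlinarith [sq_nonneg (p x - a / m)]
      · simp [hpV x hx, hx]
    rw [integral_const_mul, integral_add (f := fun x => p x * p x) (hint (hp.mul hp))
      ((integrable_const _).indicator hV.measurableSet), integral_indicator_const _ hV.measurableSet,
      ← ha, ← hb, ← hm, smul_eq_mul] at hle
    have h1 : 2 * (a / m) * a * m = 2 * a ^ 2 := by field_simp
    have h2 : m * (a / m) ^ 2 * m = a ^ 2 := by field_simp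
    nlinarith [mul_le_mul_of_nonneg_right hle hm0.le]
  let P : C₀(G, ℂ) := ZeroAtInftyContinuousMap.ContinuousMap.liftZeroAtInfty
    ⟨fun x => (p x : ℂ), Complex.continuous_ofReal.comp hp⟩
  have hval : ∀ x, toC₀ (ofConv Φ μ P P) x = ((∫ y, p y * p (y⁻¹ * x) ∂μ : ℝ) : ℂ) := by
    intro x
    rw [← integral_complex_ofReal]
    simp only [Complex.ofReal_mul]
    rfl
  have hone : ‖toC₀ (ofConv Φ μ P P) 1‖ = b := by
    rw [hval, Complex.norm_real, Real.norm_eq_abs]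
    simp only [mul_one, hsymm]
    exact abs_of_pos hb0
  have hL1 : ∫ x, ‖toC₀ (ofConv Φ μ P P) x‖ ∂μ = a ^ 2 := by
    calc ∫ x, ‖toC₀ (ofConv Φ μ P P) x‖ ∂μ = ∫ x, ∫ y, p y * p (y⁻¹ * x) ∂μ ∂μ := by
          refine integral_congr_ae (ae_of_all _ fun x => ?_)
          simp only [hval, Complex.norm_real, Real.norm_eq_abs]
          exact abs_of_nonneg (integral_nonneg fun y => mul_nonneg (hp0 y) (hp0 (y⁻¹ * x)))
      _ = ∫ y, ∫ x, p y * p (y⁻¹ * x) ∂μ ∂μ :=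
          integral_integral_swap_of_hasCompactSupport (f := fun x y => p y * p (y⁻¹ * x))
            (by simp only [Function.uncurry_def]; fun_prop) (HasCompactSupport.of_compactSpace _)
      _ = a ^ 2 := by
          simp only [integral_const_mul, integral_mul_left_eq_self (μ := μ) p, integral_mul_const]
          rw [sq]
  have hfin := hC (ofConv Φ μ P P)
  rw [hone, hL1] at hfin
  have h1 : C * a ^ 2 ≤ |C| * (m * b) :=
    mul_le_mul (le_abs_self C) hcs (sq_nonneg a) (abs_nonneg C)
  have h2 : m * (|C| + 1) < 1 := by
    rwa [← lt_div_iff₀ (by positivity), one_div]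
  nlinarith [abs_nonneg C, mul_pos hm0 hb0]

/-! ### Finite groups -/

variable [T2Space G] [Finite G]

open Classical in
/-- The indicator function of `{g}` on a finite Hausdorff group. -/
def pointIndicator (g : G) : C₀(G, ℂ) :=
  ZeroAtInftyContinuousMap.ContinuousMap.liftZeroAtInfty
    ⟨Pi.single g 1, continuous_of_discreteTopology⟩

open Classical in
lemma pointIndicator_apply (g x : G) : pointIndicator g x = if x = g then 1 else 0 :=
  Pi.single_apply g (1 : ℂ) x

lemma measureReal_singleton_one_ne_zero : (μ.real {(1 : G)} : ℂ) ≠ 0 := by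
  have := (isOpen_discrete {(1 : G)}).measure_pos μ (Set.singleton_nonempty 1)
  exact_mod_cast (ENNReal.toReal_pos this.ne' (measure_ne_top _ _)).ne'

lemma convC₀_pointIndicator (g : G) (u : C₀(G, ℂ)) (x : G) :
    convC₀ μ (pointIndicator g) u x = μ.real {(1 : G)} * u (g⁻¹ * x) := by
  classical
  have hind : (fun y => pointIndicator g y * u (y⁻¹ * x)) =
      Set.indicator {g} fun y => u (y⁻¹ * x) := by
    ext y
    by_cases hy : y = g <;> simp [pointIndicator_apply, hy]
  have hg : μ.real {g} = μ.real {(1 : G)} := by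
    have := measure_preimage_mul μ g⁻¹ {(1 : G)}
    rw [measureReal_def, measureReal_def, ← this]
    congr 2
    ext y
    simp
  rw [convC₀_apply, conv, hind, integral_indicator (measurableSet_singleton g),
    integral_singleton, hg]
  simp

variable (Φ μ) in
/-- The point mass at `g` as an element of `A_Φ(G)`, normalized so that convolution with respect
to `μ` follows the multiplication of `G`. -/
def pointMass (g : G) : HerzAlgebra Φ μ :=
  ((μ.real {(1 : G)} : ℂ)⁻¹ * (μ.real {(1 : G)} : ℂ)⁻¹) •
    ofConv Φ μ (pointIndicator 1) (pointIndicator g)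

lemma toC₀_pointMass (g : G) :
    toC₀ (pointMass Φ μ g) = (μ.real {(1 : G)} : ℂ)⁻¹ • pointIndicator g := by
  ext x
  have hk := measureReal_singleton_one_ne_zero (μ := μ)
  rw [pointMass, map_smul, toC₀_ofConv, ZeroAtInftyContinuousMap.smul_apply,
    convC₀_pointIndicator, ZeroAtInftyContinuousMap.smul_apply]
  simp only [smul_eq_mul, inv_one, one_mul]
  field_simp

lemma pointMass_mul (g h : G) : pointMass Φ μ g * pointMass Φ μ h = pointMass Φ μ (g * h) := by
  classical
  apply toC₀_injective
  ext x
  have hk := measureReal_singleton_one_ne_zero (μ := μ)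
  have hsmul : toC₀ (pointMass Φ μ g * pointMass Φ μ h) =
      (μ.real {(1 : G)} : ℂ)⁻¹ • convC₀ μ (pointIndicator g) (toC₀ (pointMass Φ μ h)) := by
    ext y
    rw [toC₀_mul, toC₀_pointMass g, ZeroAtInftyContinuousMap.smul_apply]
    simp only [convC₀_apply, conv, ZeroAtInftyContinuousMap.smul_apply, smul_eq_mul, mul_assoc,
      integral_const_mul]
  rw [hsmul, ZeroAtInftyContinuousMap.smul_apply, convC₀_pointIndicator, toC₀_pointMass,
    toC₀_pointMass]
  simp only [ZeroAtInftyContinuousMap.smul_apply, pointIndicator_apply, smul_eq_mul]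
  field_simp
  exact if_congr inv_mul_eq_iff_eq_mul rfl rfl

lemma span_pointMass : Submodule.span ℂ (Set.range (pointMass (G := G) Φ μ)) = ⊤ := by
  classical
  have := Fintype.ofFinite G
  refine eq_top_iff.2 fun u _ => ?_
  have hu : u = ∑ g, (toC₀ u g * μ.real {(1 : G)}) • pointMass Φ μ g := by
    apply toC₀_injective
    ext x
    have hk := measureReal_singleton_one_ne_zero (μ := μ)
    let ev : C₀(G, ℂ) →+ ℂ := { toFun := fun w => w x, map_zero' := rfl, map_add' := fun _ _ => rfl }
    have hev : ∀ w, ev w = w x := fun _ => rfl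
    rw [← hev, ← hev, map_sum, map_sum]
    simp [hev, toC₀_pointMass, pointIndicator_apply, hk]
  rw [hu]
  exact Submodule.sum_mem _ fun g _ =>
    Submodule.smul_mem _ _ (Submodule.subset_span (Set.mem_range_self g))

end Orlicz.HerzAlgebra

end

theorem corollary3p6 {G : Type u} [Group G] [TopologicalSpace G] [IsTopologicalGroup G]
    [CompactSpace G] [T2Space G] [MeasurableSpace G] [BorelSpace G]
    (μ : Measure G) [μ.IsHaarMeasure] [μ.Regular] (Φ : Orlicz.NFunction) :
    [BanachAlg.HasBoundedApproximateIdentity (Orlicz.HerzAlgebra Φ μ),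
      BanachAlg.IsUnital (Orlicz.HerzAlgebra Φ μ),
      BanachAlg.IsAmenable (Orlicz.HerzAlgebra Φ μ),
      Finite G].TFAE := by
  tfae_have 2 → 1 := fun h => h.hasBoundedApproximateIdentity
  tfae_have 1 → 4 := fun h => Orlicz.HerzAlgebra.finite_of_norm_apply_one_le
    (Orlicz.HerzAlgebra.norm_apply_one_le_of_hasBoundedApproximateIdentity h)
  tfae_have 3 → 4 := fun h => Orlicz.HerzAlgebra.finite_of_norm_apply_one_le
    (Orlicz.HerzAlgebra.norm_apply_one_le_of_isAmenable h)
  tfae_have 4 → 2 := fun _ => BanachAlg.isUnital_of_span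
    Orlicz.HerzAlgebra.pointMass_mul Orlicz.HerzAlgebra.span_pointMass
  tfae_have 4 → 3 := fun _ => BanachAlg.isAmenable_of_span
    Orlicz.HerzAlgebra.pointMass_mul Orlicz.HerzAlgebra.span_pointMass
  tfae_finish
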